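/- Let $SU(2)$ carry its Haar measure $du$ of total mass one, and let $L^p(SU(2))$ be the space of complex-valued measurable functions $f$ with $\|f\|_{L^p(SU(2))}^p=\int_{SU(2)}|f(u)|^p\,du<\infty$. Write $\mathbb N_0=\{0,1,2,\dots\}$. For $l\in\frac12\mathbb N_0$ let $V_l\subset\mathbb C[z_1,z_2]$ be the $(2l+1)$-dimensional space of homogeneous polynomials of degree $2l$, and let $t^l(u)\in\mathbb C^{(2l+1)\times(2l+1)}$ be the unitary matrix, in the orthonormal basis $z_1^{k}z_2^{2l-k}/\sqrt{k!\,(2l-k)!}$ $(0\le k\le 2l)$, of the irreducible representation $(t^l(u)g)(z)=g(zu)$ of $SU(2)$ on $V_l$, where $z=(z_1,z_2)$ is a row vector. For $f\in L^1(SU(2))$ put $$\widehat f(l)=\int_{SU(2)}f(u)\,t^l(u)^*\,du,\qquad \|\widehat f(l)\|_{HS}=\sqrt{\operatorname{Tr}\big(\widehat f(l)\widehat f(l)^*\big)}.$$ **Theorem.** Let $1<p\le 2$. There is a constant $c_p>0$, depending only on $p$, such that for every $f\in L^p(SU(2))$ $$\sum_{l\in\frac12\mathbb N_0}(2l+1)^{\frac52p-4}\,\|\widehat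 f(l)\|_{HS}^p\;\le\; c_p\,\|f\|_{L^p(SU(2))}^p ,$$ the series on the left being convergent. For $p=2$, where the left-hand side is $\sum_{l}(2l+1)\|\widehat f(l)\|_{HS}^2$, one has the Plancherel identity: for every $f\in L^2(SU(2))$, $$\sum_{l\in\frac12\mathbb N_0}(2l+1)\,\|\widehat f(l)\|_{HS}^2=\|f\|_{L^2(SU(2))}^2 .$$ -/

import Mathlib

open MeasureTheory
open scoped Nat ENNReal Matrix

namespace SUTwo

/-- The group `SU(2)` of unitary `2 × 2` complex matrices of determinant one, with the topology
induced from the space of matrices. -/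
abbrev SU2 : Type := Matrix.specialUnitaryGroup (Fin 2) ℂ

instance instIsTopologicalGroupSU2 : IsTopologicalGroup SU2 where
  continuous_mul := by fun_prop
  continuous_inv :=
    Continuous.subtype_mk (Continuous.matrix_conjTranspose continuous_subtype_val) _

instance instCompactSpaceSU2 : CompactSpace SU2 := by
  have hclosed : IsClosed ((Matrix.specialUnitaryGroup (Fin 2) ℂ :
      Submonoid (Matrix (Fin 2) (Fin 2) ℂ)) : Set (Matrix (Fin 2) (Fin 2) ℂ)) := by
    have h : ((Matrix.specialUnitaryGroup (Fin 2) ℂ :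
      Submonoid (Matrix (Fin 2) (Fin 2) ℂ)) : Set (Matrix (Fin 2) (Fin 2) ℂ)) =
        {A | A * Aᴴ = 1} ∩ {A | A.det = 1} := by
      ext A
      simp only [SetLike.mem_coe, Matrix.mem_specialUnitaryGroup_iff,
        Matrix.mem_unitaryGroup_iff, Set.mem_inter_iff, Set.mem_ofPred_eq]
      rfl
    rw [h]
    exact (isClosed_eq (by fun_prop) continuous_const).inter
      (isClosed_eq (by fun_prop) continuous_const)
  have hsub : ((Matrix.specialUnitaryGroup (Fin 2) ℂ :
      Submonoid (Matrix (Fin 2) (Fin 2) ℂ)) : Set (Matrix (Fin 2) (Fin 2) ℂ)) ⊆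
        Set.pi Set.univ (fun _ => Set.pi Set.univ (fun _ => Metric.closedBall (0 : ℂ) 1)) := by
    intro A hA i _ j _
    simpa using entry_norm_bound_of_unitary hA.1 i j
  have hcpt : IsCompact (Set.pi Set.univ (fun _ : Fin 2 => Set.pi Set.univ
      (fun _ : Fin 2 => Metric.closedBall (0 : ℂ) 1))) :=
    isCompact_univ_pi fun _ => isCompact_univ_pi fun _ => isCompact_closedBall _ _
  exact isCompact_iff_compactSpace.mp (hcpt.of_isClosed_subset hclosed hsub)

noncomputable instance instMeasurableSpaceSU2 : MeasurableSpace SU2 := borel SU2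

instance instBorelSpaceSU2 : BorelSpace SU2 := ⟨rfl⟩

/-- The Haar measure on `SU(2)`, normalized to have total mass one. -/
noncomputable def haarSU2 : Measure SU2 := Measure.haarMeasure ⊤

/-- The action `(T(u) f)(z) = f(z u)` of `SU(2)` on polynomials in `z = (z₁, z₂)`, where `z` is a
row vector: the variable `z_j` is replaced by `(z u)_j = ∑ i, u i j * z_i`. -/
noncomputable def polyAction (u : SU2) :
    MvPolynomial (Fin 2) ℂ →ₐ[ℂ] MvPolynomial (Fin 2) ℂ :=
  MvPolynomial.aeval fun j => ∑ i, MvPolynomial.C (u.1 i j) * MvPolynomial.X i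

/-- The exponent of the monomial `z₁ ^ k * z₂ ^ (n - k)`. -/
noncomputable def expo (n : ℕ) (k : Fin (n + 1)) : Fin 2 →₀ ℕ :=
  Finsupp.single 0 (k : ℕ) + Finsupp.single 1 (n - k)

/-- The normalizing factor `√(k! (n - k)!)`. -/
noncomputable def normFactor (n : ℕ) (k : Fin (n + 1)) : ℝ :=
  Real.sqrt ((k : ℕ)! * (n - k)!)

/-- The vectors `z₁ ^ k * z₂ ^ (n - k) / √(k! (n - k)!)`, `0 ≤ k ≤ n`. They form a basis of the
space of homogeneous polynomials of degree `n = 2 l`, orthonormal for the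
`SU(2)`-invariant inner product. -/
noncomputable def basisPoly (n : ℕ) (k : Fin (n + 1)) : MvPolynomial (Fin 2) ℂ :=
  MvPolynomial.monomial (expo n k) (((normFactor n k)⁻¹ : ℝ) : ℂ)

/-- The matrix of the irreducible unitary representation `t^l`, `n = 2 l`, that is, of the action
`(t^l(u) f)(z) = f(z u)` on the homogeneous polynomials of degree `n`, in the orthonormal basis
`basisPoly n`. The entry `(m, k)` is the `m`-th coordinate of `t^l(u) (basisPoly n k)`. -/
noncomputable def rep (n : ℕ) (u : SU2) : Matrix (Fin (n + 1)) (Fin (n + 1)) ℂ :=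
  Matrix.of fun m k =>
    (normFactor n m : ℂ) * MvPolynomial.coeff (expo n m) (polyAction u (basisPoly n k))

/-- The Fourier coefficient `∫ f(u) t^l(u)^* du`, `n = 2 l`, a matrix of size `2 l + 1 = n + 1`;
the integral is taken entry by entry. -/
noncomputable def fourierCoeff (f : SU2 → ℂ) (n : ℕ) : Matrix (Fin (n + 1)) (Fin (n + 1)) ℂ :=
  Matrix.of fun i j => ∫ u, f u * (rep n u)ᴴ i j ∂haarSU2

/-- The Hilbert-Schmidt norm `√(Tr (A A^*))`. -/
noncomputable def hsNorm {n : ℕ} (A : Matrix (Fin n) (Fin n) ℂ) : ℝ :=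
  Real.sqrt (A * Aᴴ).trace.re

end SUTwo

namespace SUTwo

/-! ### The representations -/

/-! With `n = 2l`, the Plancherel identity is the Peter–Weyl theorem for SU(2): the functions
`√(n+1) t^n_{ij}` form a Hilbert basis of `L²`. Unitarity comes from the invariance of the kernel
`⟨z,w⟩^n / n!`. Orthogonality is Schur's lemma, applied to averages over the group: commuting with
the diagonal torus forces an intertwiner to preserve weights, and one rotation with no zero in its
last column ties all weights together. Completeness is Stone–Weierstrass: the span of the matrix
coefficients is stable under multiplication by the entries of `u` (`entryMap_mul_coefMap_mem`), so
it contains the algebra they generate.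

The inequality is Marcinkiewicz interpolation for the sublinear map `f ↦ a(n) = (n+1)^(5/2)
‖f̂(n)‖`, from functions on SU(2) to sequences on `ℕ` with masses `(n+1)^(-4)`; the `p`-th power
integral of `a` is the left-hand side. At `p = 2` Plancherel preserves the norm. At `p = 1`, `a(n) ≤
(n+1)^3 ‖f‖₁`, while `{n : (n+1)^3 > R}` has mass at most `3/R`: weak type `(1,1)`. Cutting `f` at
height `t` and integrating over `t` (`lintegral_rpow_le_of_weak_type`) gives `1 < p < 2`. -/

lemma normFactor_pos (n : ℕ) (k : Fin (n + 1)) : 0 < normFactor n k :=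
  Real.sqrt_pos.2 (by positivity)

lemma normFactor_ne_zero (n : ℕ) (k : Fin (n + 1)) : (normFactor n k : ℂ) ≠ 0 :=
  Complex.ofReal_ne_zero.2 (normFactor_pos n k).ne'

lemma expo_injective (n : ℕ) : Function.Injective (expo n) := by
  intro j k h
  have := DFunLike.congr_fun h 0
  simp [expo] at this
  exact Fin.ext this

lemma exists_expo_of_degree {n : ℕ} {d : Fin 2 →₀ ℕ} (hd : d.degree = n) :
    ∃ k, d = expo n k := by
  rw [Finsupp.degree_eq_sum, Fin.sum_univ_two] at hd
  refine ⟨⟨d 0, by omega⟩, ?_⟩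
  ext i
  fin_cases i
  · simp [expo]
  · simp [expo]; omega

lemma coeff_basisPoly (n : ℕ) (k m : Fin (n + 1)) :
    MvPolynomial.coeff (expo n m) (basisPoly n k) = if k = m then ((normFactor n m : ℂ))⁻¹ else 0 := by
  rw [basisPoly, MvPolynomial.coeff_monomial]
  by_cases h : k = m
  · simp [h]
  · rw [if_neg h, if_neg fun h' => h (expo_injective n h')]

lemma eq_sum_basisPoly {n : ℕ} {g : MvPolynomial (Fin 2) ℂ} (hg : g.IsHomogeneous n) :
    g = ∑ m, ((normFactor n m : ℂ) * MvPolynomial.coeff (expo n m) g) • basisPoly n m := by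
  ext d
  by_cases hd : d.degree = n
  · obtain ⟨k, rfl⟩ := exists_expo_of_degree hd
    simp only [MvPolynomial.coeff_sum, MvPolynomial.coeff_smul, coeff_basisPoly, smul_eq_mul,
      mul_ite, mul_zero, Finset.sum_ite_eq', Finset.mem_univ, if_true]
    field_simp [normFactor_ne_zero n k]
  · rw [hg.coeff_eq_zero hd, MvPolynomial.coeff_sum]
    refine (Finset.sum_eq_zero fun m _ => ?_).symm
    rw [MvPolynomial.coeff_smul, basisPoly, MvPolynomial.coeff_monomial, if_neg, smul_zero]
    rintro rfl
    apply hd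
    rw [Finsupp.degree_eq_sum, Fin.sum_univ_two]
    simp [expo]
    omega

lemma basisPoly_isHomogeneous (n : ℕ) (k : Fin (n + 1)) : (basisPoly n k).IsHomogeneous n := by
  refine MvPolynomial.isHomogeneous_monomial _ ?_
  rw [Finsupp.degree_eq_sum, Fin.sum_univ_two]
  simp [expo]
  omega

lemma polyAction_isHomogeneous (u : SU2) {g : MvPolynomial (Fin 2) ℂ} {n : ℕ}
    (hg : g.IsHomogeneous n) : (polyAction u g).IsHomogeneous n := by
  have h := hg.aeval (fun j => ∑ i, MvPolynomial.C (u.1 i j) * MvPolynomial.X i) (n := 1)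
    fun j => MvPolynomial.IsHomogeneous.sum _ _ _ fun i _ =>
      MvPolynomial.IsHomogeneous.C_mul (MvPolynomial.isHomogeneous_X ℂ i) _
  rwa [one_mul] at h

lemma polyAction_basisPoly (u : SU2) (n : ℕ) (k : Fin (n + 1)) :
    polyAction u (basisPoly n k) = ∑ m, rep n u m k • basisPoly n m :=
  eq_sum_basisPoly (polyAction_isHomogeneous u (basisPoly_isHomogeneous n k))

lemma polyAction_mul (u v : SU2) (g : MvPolynomial (Fin 2) ℂ) :
    polyAction (u * v) g = polyAction u (polyAction v g) := by
  suffices h : polyAction (u * v) = (polyAction u).comp (polyAction v) by rw [h]; rfl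
  refine MvPolynomial.algHom_ext fun j => ?_
  simp only [polyAction, AlgHom.comp_apply, MvPolynomial.aeval_X, map_mul,
    Fin.sum_univ_two, Submonoid.coe_mul, Matrix.mul_apply, MvPolynomial.algHom_C, map_add,
    MvPolynomial.algebraMap_eq]
  ring

lemma rep_mul (n : ℕ) (u v : SU2) : rep n (u * v) = rep n u * rep n v := by
  ext m k
  rw [Matrix.mul_apply]
  conv_lhs => rw [rep, Matrix.of_apply, polyAction_mul, polyAction_basisPoly]
  simp only [map_sum, map_smul, MvPolynomial.coeff_sum, MvPolynomial.coeff_smul, Finset.mul_sum,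
    smul_eq_mul]
  refine Finset.sum_congr rfl fun j _ => ?_
  conv_rhs => rw [rep, Matrix.of_apply]
  ring

/-- The orthonormal basis functions as functions on `ℂ²`. -/
noncomputable def basisFun (n : ℕ) (k : Fin (n + 1)) (z : Fin 2 → ℂ) : ℂ :=
  (normFactor n k : ℂ)⁻¹ * (z 0 ^ (k : ℕ) * z 1 ^ (n - k))

lemma eval_basisPoly (n : ℕ) (k : Fin (n + 1)) (z : Fin 2 → ℂ) :
    MvPolynomial.eval z (basisPoly n k) = basisFun n k z := by
  rw [basisPoly, MvPolynomial.eval_monomial, basisFun, Complex.ofReal_inv, expo,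
    Finsupp.prod_fintype _ _ (by simp), Fin.prod_univ_two]
  simp

lemma eval_polyAction (u : SU2) (z : Fin 2 → ℂ) (g : MvPolynomial (Fin 2) ℂ) :
    MvPolynomial.eval z (polyAction u g) = MvPolynomial.eval (z ᵥ* u.1) g := by
  suffices h : (MvPolynomial.aeval z).comp (polyAction u) = MvPolynomial.aeval (R := ℂ) (z ᵥ* u.1) by
    simpa [MvPolynomial.aeval_eq_eval] using DFunLike.congr_fun h g
  refine MvPolynomial.algHom_ext fun j => ?_
  simp [polyAction, Matrix.vecMul, dotProduct, Fin.sum_univ_two, mul_comm]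

lemma basisFun_vecMul (u : SU2) (n : ℕ) (k : Fin (n + 1)) (z : Fin 2 → ℂ) :
    basisFun n k (z ᵥ* u.1) = ∑ m, rep n u m k * basisFun n m z := by
  rw [← eval_basisPoly, ← eval_polyAction, polyAction_basisPoly]
  simp [eval_basisPoly, MvPolynomial.smul_eval]

/-- On the line `z = (x, 1)` the functions become nonzero multiples of distinct powers of `x`. -/
lemma basisFun_linearIndependent {n : ℕ} {c : Fin (n + 1) → ℂ}
    (h : ∀ z, ∑ m, c m * basisFun n m z = 0) : c = 0 := by
  have hp : (∑ m : Fin (n + 1), Polynomial.C (c m * (normFactor n m : ℂ)⁻¹) *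
      Polynomial.X ^ (m : ℕ)) = 0 := by
    refine Polynomial.funext fun x => ?_
    rw [Polynomial.eval_zero, ← h ![x, 1], Polynomial.eval_finsetSum]
    refine Finset.sum_congr rfl fun m _ => ?_
    simp [basisFun, mul_assoc]
  funext k
  have := congrArg (fun q => Polynomial.coeff q k) hp
  simp only [Polynomial.finsetSum_coeff, Polynomial.coeff_C_mul, Polynomial.coeff_X_pow,
    Polynomial.coeff_zero, mul_ite, mul_one, mul_zero, Fin.val_inj, Finset.sum_ite_eq,
    Finset.mem_univ, if_true] at this
  exact (mul_eq_zero.1 this).resolve_right (inv_ne_zero (normFactor_ne_zero n k))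

/-- The binomial theorem: `1 / (k! (n-k)!)` is `n.choose k / n!`. The right side depends only on the
Hermitian product, hence is invariant under unitary substitutions. -/
lemma sum_basisFun_mul_conj (n : ℕ) (z w : Fin 2 → ℂ) :
    ∑ k, basisFun n k z * star (basisFun n k w) = (z ⬝ᵥ star w) ^ n / (n ! : ℂ) := by
  rw [dotProduct, Fin.sum_univ_two, add_pow, Finset.sum_range, Finset.sum_div]
  refine Finset.sum_congr rfl fun k _ => ?_
  have hk : (k : ℕ) ≤ n := Nat.lt_succ_iff.1 k.2
  have h1 : (normFactor n k : ℂ) * normFactor n k = ((k : ℕ)! : ℂ) * ((n - k)! : ℂ) := by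
    rw [← Complex.ofReal_mul, normFactor, Real.mul_self_sqrt (by positivity)]
    push_cast
    rfl
  have h2 : (n.choose k : ℂ) * ((k : ℕ)! : ℂ) * ((n - k)! : ℂ) = n ! := by
    exact_mod_cast Nat.choose_mul_factorial_mul_factorial hk
  have h3 : ((k : ℕ)! : ℂ) ≠ 0 := by exact_mod_cast Nat.factorial_ne_zero _
  have h4 : ((n - k)! : ℂ) ≠ 0 := by exact_mod_cast Nat.factorial_ne_zero _
  have h5 : (n.choose k : ℂ) ≠ 0 := by exact_mod_cast (Nat.choose_pos hk).ne'
  have h6 : ((normFactor n k : ℂ)⁻¹ * (normFactor n k : ℂ)⁻¹) = (n.choose k : ℂ) / n ! := by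
    rw [← mul_inv, h1, ← h2]
    field_simp
  simp only [basisFun, star_mul', star_pow, Pi.star_apply, mul_pow, star_inv₀, RCLike.star_def,
    Complex.conj_ofReal]
  linear_combination (z 0 ^ (k : ℕ) * z 1 ^ (n - k) * ((starRingEnd ℂ) (w 0) ^ (k : ℕ) *
    (starRingEnd ℂ) (w 1) ^ (n - k))) * h6

lemma dotProduct_star_vecMul (u : SU2) (z w : Fin 2 → ℂ) :
    (z ᵥ* u.1) ⬝ᵥ star (w ᵥ* u.1) = z ⬝ᵥ star w := by
  have h : u.1 * u.1ᴴ = 1 := Matrix.mem_unitaryGroup_iff.1 (Matrix.mem_specialUnitaryGroup_iff.1 u.2).1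
  rw [Matrix.star_vecMul, ← Matrix.dotProduct_mulVec, Matrix.mulVec_mulVec, h, Matrix.one_mulVec]

/-- Invariance of the kernel says that the form with matrix `t t^* - 1` vanishes at all `z, w`;
linear independence in `z`, then in `w`, kills the matrix. -/
lemma rep_mul_conjTranspose (n : ℕ) (u : SU2) : rep n u * (rep n u)ᴴ = 1 := by
  have key : ∀ z w, ∑ m, (∑ l, (rep n u * (rep n u)ᴴ - 1) m l * star (basisFun n l w)) *
      basisFun n m z = 0 := by
    intro z w
    have h := sum_basisFun_mul_conj n (z ᵥ* u.1) (w ᵥ* u.1)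
    rw [dotProduct_star_vecMul, ← sum_basisFun_mul_conj n z w] at h
    simp only [basisFun_vecMul] at h
    have e1 : ∑ m, (∑ l, (1 : Matrix (Fin (n + 1)) (Fin (n + 1)) ℂ) m l *
        star (basisFun n l w)) * basisFun n m z = ∑ k, basisFun n k z * star (basisFun n k w) := by
      simp [Matrix.one_apply, mul_comm]
    have e2 : ∑ m, (∑ l, (rep n u * (rep n u)ᴴ) m l * star (basisFun n l w)) * basisFun n m z =
        ∑ k, (∑ m, rep n u m k * basisFun n m z) * star (∑ m, rep n u m k * basisFun n m w) := by
      simp only [Matrix.mul_apply, Finset.sum_mul, star_sum, Finset.mul_sum, star_mul',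
        Matrix.conjTranspose_apply]
      rw [Finset.sum_congr rfl fun m _ => Finset.sum_comm]
      rw [Finset.sum_comm]
      refine Finset.sum_congr rfl fun k _ => ?_
      rw [Finset.sum_comm]
      refine Finset.sum_congr rfl fun m _ => Finset.sum_congr rfl fun l _ => ?_
      ring
    simp only [Matrix.sub_apply, sub_mul, Finset.sum_sub_distrib]
    rw [e1, e2, h, sub_self]
  rw [← sub_eq_zero]
  ext m l
  have h1 := fun w => congrFun (basisFun_linearIndependent fun z => key z w) m
  -- The dependence on `w` is antilinear, so conjugate before using independence again.
  have h2 := basisFun_linearIndependent (c := fun l => star ((rep n u * (rep n u)ᴴ - 1) m l))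
    fun w => by
      have := congrArg star (h1 w)
      simpa [star_sum, star_mul', -Matrix.sub_apply] using this
  exact star_eq_zero.1 (congrFun h2 l)

lemma conjTranspose_mul_rep (n : ℕ) (u : SU2) : (rep n u)ᴴ * rep n u = 1 :=
  mul_eq_one_comm.1 (rep_mul_conjTranspose n u)

/-- The unnormalized matrix coefficients: the coefficient of `X ^ m` in
`(a X + c) ^ k (b X + d) ^ j`, where `a, b, c, d` are the entries of the matrix. -/
noncomputable def coef (k j m : ℕ) (u : Matrix (Fin 2) (Fin 2) ℂ) : ℂ :=
  Polynomial.coeff ((Polynomial.C (u 0 0) * Polynomial.X + Polynomial.C (u 1 0)) ^ k *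
    (Polynomial.C (u 0 1) * Polynomial.X + Polynomial.C (u 1 1)) ^ j) m

/-- Dehomogenization at `z = (x, 1)`, where `z u = (a x + c, b x + d)`. -/
lemma rep_eq_coef (n : ℕ) (u : SU2) (m k : Fin (n + 1)) :
    rep n u m k = (normFactor n m : ℂ) * (normFactor n k : ℂ)⁻¹ * coef k (n - k) m u.1 := by
  have h : (Polynomial.C (u.1 0 0) * Polynomial.X + Polynomial.C (u.1 1 0)) ^ (k : ℕ) *
      (Polynomial.C (u.1 0 1) * Polynomial.X + Polynomial.C (u.1 1 1)) ^ (n - k : ℕ) =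
      ∑ m : Fin (n + 1), Polynomial.C ((normFactor n k : ℂ) * (normFactor n m : ℂ)⁻¹ * rep n u m k) *
        Polynomial.X ^ (m : ℕ) := by
    refine Polynomial.funext fun x => ?_
    have := congrArg ((normFactor n k : ℂ) * ·) (basisFun_vecMul u n k ![x, 1])
    simp only [basisFun, ← mul_assoc, mul_inv_cancel₀ (normFactor_ne_zero n k), one_mul,
      Finset.mul_sum] at this
    simp only [Polynomial.eval_mul, Polynomial.eval_pow, Polynomial.eval_add, Polynomial.eval_C,
      Polynomial.eval_X, Polynomial.eval_finsetSum]
    convert this using 1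
    · simp [Matrix.vecMul, dotProduct, Fin.sum_univ_two, mul_comm]
    · refine Finset.sum_congr rfl fun m _ => ?_
      simp only [Matrix.cons_val_zero, Matrix.cons_val_one, one_pow, mul_one]
      ring
  rw [coef, h]
  simp only [Polynomial.finsetSum_coeff, Polynomial.coeff_C_mul, Polynomial.coeff_X_pow,
    mul_ite, mul_one, mul_zero, Fin.val_inj, Finset.sum_ite_eq,
    Finset.mem_univ, if_true]
  field_simp [normFactor_ne_zero n k, normFactor_ne_zero n m]

lemma continuous_coef (k j m : ℕ) : Continuous (coef k j m) := by
  have hmul : ∀ p q : Matrix (Fin 2) (Fin 2) ℂ → Polynomial ℂ,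
      (∀ i, Continuous fun u => (p u).coeff i) → (∀ i, Continuous fun u => (q u).coeff i) →
      ∀ i, Continuous fun u => (p u * q u).coeff i := by
    intro p q hp hq i
    simp only [Polynomial.coeff_mul]
    exact continuous_finsetSum _ fun x _ => (hp _).mul (hq _)
  have hpow : ∀ p : Matrix (Fin 2) (Fin 2) ℂ → Polynomial ℂ,
      (∀ i, Continuous fun u => (p u).coeff i) → ∀ N i, Continuous fun u => (p u ^ N).coeff i := by
    intro p hp N
    induction N with
    | zero => intro i; simpa using continuous_const
    | succ N ih => simpa only [pow_succ] using hmul _ _ ih hp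
  have hlin : ∀ (a b : Fin 2 × Fin 2) (i : ℕ), Continuous fun u : Matrix (Fin 2) (Fin 2) ℂ =>
      (Polynomial.C (u a.1 a.2) * Polynomial.X + Polynomial.C (u b.1 b.2)).coeff i := by
    intro a b i
    simp only [Polynomial.coeff_add, Polynomial.coeff_C_mul, Polynomial.coeff_C]
    split_ifs <;> fun_prop
  exact hmul _ _ (hpow _ (hlin (0, 0) (1, 0)) k) (hpow _ (hlin (0, 1) (1, 1)) j) m

lemma continuous_rep (n : ℕ) (m k : Fin (n + 1)) : Continuous fun u : SU2 => rep n u m k := by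
  simp only [rep_eq_coef]
  exact continuous_const.mul ((continuous_coef _ _ _).comp continuous_subtype_val)

/-! ### Schur orthogonality -/

instance instIsProbabilityMeasureHaarSU2 : IsProbabilityMeasure haarSU2 :=
  ⟨Measure.haarMeasure_self⟩

instance instIsMulLeftInvariantHaarSU2 : haarSU2.IsMulLeftInvariant :=
  inferInstanceAs (Measure.haarMeasure ⊤).IsMulLeftInvariant

/-- The diagonal element `diag(α, conj α)` for `α = exp (i θ)`. -/
noncomputable def torus (θ : ℝ) : SU2 :=
  ⟨!![Complex.exp (θ * Complex.I), 0; 0, Complex.exp (-(θ * Complex.I))], by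
    rw [Matrix.mem_specialUnitaryGroup_iff, Matrix.mem_unitaryGroup_iff]
    constructor
    · ext i j
      fin_cases i <;> fin_cases j <;>
        simp [Matrix.mul_apply, Fin.sum_univ_two, Matrix.star_apply, ← Complex.exp_conj,
          ← Complex.exp_add]
    · simp [Matrix.det_fin_two, ← Complex.exp_add]⟩

/-- A rotation all of whose entries are nonzero. -/
noncomputable def rotation : SU2 :=
  ⟨!![3 / 5, -4 / 5; 4 / 5, 3 / 5], by
    rw [Matrix.mem_specialUnitaryGroup_iff, Matrix.mem_unitaryGroup_iff]
    constructor
    · ext i j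
      fin_cases i <;> fin_cases j <;>
        simp [Matrix.mul_apply, Fin.sum_univ_two, Matrix.star_apply, map_ofNat] <;> norm_num
    · simp [Matrix.det_fin_two]; norm_num⟩

lemma rep_torus (θ : ℝ) (n : ℕ) : rep n (torus θ) =
    Matrix.diagonal fun k : Fin (n + 1) => Complex.exp (((2 * (k : ℕ) - n : ℝ) * θ) * Complex.I) := by
  ext m k
  have hk : (k : ℕ) ≤ n := Nat.lt_succ_iff.1 k.2
  have h : coef k (n - k) m (torus θ).1 =
      if m = k then Complex.exp (((2 * (k : ℕ) - n : ℝ) * θ) * Complex.I) else 0 := by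
    simp only [coef, torus, Matrix.cons_val', Matrix.cons_val_zero, Matrix.cons_val_one,
      Matrix.cons_val_fin_one, Matrix.of_apply, Polynomial.C_0, add_zero, zero_mul, zero_add,
      mul_pow, ← Polynomial.C_pow]
    rw [mul_right_comm, ← Polynomial.C_mul, Polynomial.coeff_C_mul, Polynomial.coeff_X_pow,
      ← Complex.exp_nat_mul, ← Complex.exp_nat_mul, ← Complex.exp_add, mul_ite, mul_one, mul_zero]
    simp only [Fin.val_inj]
    congr 2
    push_cast [Nat.cast_sub hk]
    ring
  rw [rep_eq_coef, h, Matrix.diagonal_apply]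
  split_ifs with hmk
  · subst hmk
    rw [mul_inv_cancel₀ (normFactor_ne_zero n m), one_mul]
  · simp

/-- Up to nonzero factors, the last column lists the coefficients of `(3/5 X + 4/5)^n`, all nonzero
by the binomial theorem. -/
lemma rep_rotation_last_ne_zero (n : ℕ) (m : Fin (n + 1)) :
    rep n rotation m (Fin.last n) ≠ 0 := by
  have h : coef n 0 m rotation.1 ≠ 0 := by
    have e : (Polynomial.C (3 / 5 : ℂ) * Polynomial.X + Polynomial.C (4 / 5 : ℂ)) =
        Polynomial.C (3 / 5 : ℂ) * (Polynomial.X + Polynomial.C (4 / 3 : ℂ)) := by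
      rw [mul_add, ← Polynomial.C_mul]; norm_num
    simp only [coef, rotation, Matrix.cons_val', Matrix.cons_val_zero, Matrix.cons_val_one,
      Matrix.cons_val_fin_one, Matrix.of_apply, pow_zero, mul_one]
    rw [e, mul_pow, ← Polynomial.C_pow, Polynomial.coeff_C_mul, Polynomial.coeff_X_add_C_pow]
    have : ((n.choose m : ℕ) : ℂ) ≠ 0 := by
      exact_mod_cast (Nat.choose_pos (Nat.lt_succ_iff.1 m.2)).ne'
    simp [this]
  rw [rep_eq_coef]
  simp only [Fin.val_last, Nat.sub_self]
  exact mul_ne_zero (mul_ne_zero (normFactor_ne_zero _ _) (inv_ne_zero (normFactor_ne_zero _ _))) h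

/-! ### Schur's lemma by weights -/

section Intertwiner

variable {m n : ℕ} {A : Matrix (Fin (m + 1)) (Fin (n + 1)) ℂ}

/-- A matrix commuting with the torus preserves weights. -/
lemma intertwiner_apply_eq_zero (hA : ∀ v, rep m v * A = A * rep n v) {j : Fin (m + 1)}
    {k : Fin (n + 1)} (hjk : (2 * (j : ℕ) - m : ℤ) ≠ 2 * (k : ℕ) - n) : A j k = 0 := by
  set D : ℝ := (2 * (j : ℕ) - m : ℝ) - (2 * (k : ℕ) - n) with hD
  have hD0 : D ≠ 0 := by
    intro h
    rw [hD, sub_eq_zero] at h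
    exact hjk (by exact_mod_cast h)
  -- At angle `π / D` the two torus eigenvalues are opposite, so `A j k = -A j k`.
  have h := congrFun (congrFun (hA (torus (Real.pi / D))) j) k
  rw [rep_torus, rep_torus, Matrix.diagonal_mul, Matrix.mul_diagonal] at h
  have e : Complex.exp (((2 * (j : ℕ) - m : ℝ) * (Real.pi / D : ℝ)) * Complex.I) =
      -Complex.exp (((2 * (k : ℕ) - n : ℝ) * (Real.pi / D : ℝ)) * Complex.I) := by
    have e1 : (((2 * (j : ℕ) - m : ℝ) * (Real.pi / D : ℝ)) * Complex.I) =
        (((2 * (k : ℕ) - n : ℝ) * (Real.pi / D : ℝ)) * Complex.I) + Real.pi * Complex.I := by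
      have : ((2 * (j : ℕ) - m : ℝ) : ℂ) = ((2 * (k : ℕ) - n : ℝ) : ℂ) + (D : ℂ) := by
        rw [hD]; push_cast; ring
      have hD1 : (D : ℂ) ≠ 0 := Complex.ofReal_ne_zero.2 hD0
      rw [this]
      push_cast
      field_simp
    rw [e1, Complex.exp_add, Complex.exp_pi_mul_I, mul_neg_one]
  rw [e] at h
  have h2 : 2 * Complex.exp (((2 * (k : ℕ) - n : ℝ) * (Real.pi / D : ℝ)) * Complex.I) * A j k = 0 := by
    linear_combination -h
  simpa [Complex.exp_ne_zero] using h2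

/-- The top weight `n` does not occur in the smaller representation, so the last column of `A`
vanishes. In the last column of the relation for the rotation, each row then reduces to its single
weight-matching entry of `A` times a nonzero number. -/
lemma intertwiner_eq_zero_of_lt (hA : ∀ v, rep m v * A = A * rep n v) (hmn : m < n) : A = 0 := by
  have hlast : ∀ j, A j (Fin.last n) = 0 := fun j =>
    intertwiner_apply_eq_zero hA (by have := j.2; simp only [Fin.val_last]; omega)
  ext j k
  have h := congrFun (congrFun (hA rotation) j) (Fin.last n)
  rw [Matrix.mul_apply, Matrix.mul_apply] at h
  simp only [hlast, mul_zero, Finset.sum_const_zero] at h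
  by_cases hjk : (2 * (j : ℕ) - m : ℤ) = 2 * (k : ℕ) - n
  · rw [Finset.sum_eq_single k] at h
    · exact (mul_eq_zero.1 h.symm).resolve_right (rep_rotation_last_ne_zero n k)
    · intro i _ hi
      rw [intertwiner_apply_eq_zero hA, zero_mul]
      intro h'
      exact hi (Fin.ext (by omega))
    · simp
  · exact intertwiner_apply_eq_zero hA hjk

/-- By unitarity the adjoint intertwines in the opposite direction, which reduces `m > n` to `m <
n`. -/
lemma intertwiner_conjTranspose (hA : ∀ v, rep m v * A = A * rep n v) (v : SU2) :
    rep n v * Aᴴ = Aᴴ * rep m v := by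
  have h1 : (rep m v)ᴴ * A = A * (rep n v)ᴴ := by
    calc (rep m v)ᴴ * A = (rep m v)ᴴ * (A * rep n v) * (rep n v)ᴴ := by
          rw [Matrix.mul_assoc, Matrix.mul_assoc, rep_mul_conjTranspose, Matrix.mul_one]
      _ = A * (rep n v)ᴴ := by
          rw [← hA, ← Matrix.mul_assoc, conjTranspose_mul_rep, Matrix.one_mul]
  have h2 := congrArg Matrix.conjTranspose h1
  simpa [Matrix.conjTranspose_mul] using h2.symm

lemma intertwiner_eq_zero (hA : ∀ v, rep m v * A = A * rep n v) (hmn : m ≠ n) : A = 0 := by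
  rcases hmn.lt_or_gt with h | h
  · exact intertwiner_eq_zero_of_lt hA h
  · exact Matrix.conjTranspose_eq_zero.1 (intertwiner_eq_zero_of_lt (intertwiner_conjTranspose hA) h)

/-- The weights are distinct, so `A` is diagonal; the last column of the relation for the rotation
equates every diagonal entry with the last one. -/
lemma intertwiner_eq_scalar {A : Matrix (Fin (n + 1)) (Fin (n + 1)) ℂ}
    (hA : ∀ v, rep n v * A = A * rep n v) :
    A = Matrix.scalar _ (A (Fin.last n) (Fin.last n)) := by
  have hdiag : ∀ {j k}, j ≠ k → A j k = 0 := fun {j k} hjk =>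
    intertwiner_apply_eq_zero hA fun h => hjk (Fin.ext (by omega))
  ext j k
  by_cases hjk : j = k
  · subst hjk
    have h := congrFun (congrFun (hA rotation) j) (Fin.last n)
    rw [Matrix.mul_apply, Matrix.mul_apply,
      Finset.sum_eq_single (Fin.last n) (fun i _ hi => by rw [hdiag hi, mul_zero]) (by simp),
      Finset.sum_eq_single j (fun i _ hi => by rw [hdiag hi.symm, zero_mul]) (by simp)] at h
    have h3 := rep_rotation_last_ne_zero n j
    rw [mul_comm] at h
    simpa using (mul_right_cancel₀ h3 h).symm
  · simp [hdiag hjk, hjk]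

end Intertwiner

lemma integrable_of_continuous {g : SU2 → ℂ} (hg : Continuous g) : Integrable g haarSU2 :=
  hg.integrable_of_hasCompactSupport (HasCompactSupport.of_compactSpace g)

lemma integrable_rep_mul_conj (m n : ℕ) (i j : Fin (m + 1)) (k l : Fin (n + 1)) :
    Integrable (fun u => rep m u i j * star (rep n u k l)) haarSU2 :=
  integrable_of_continuous ((continuous_rep _ _ _).mul (continuous_rep _ _ _).star)

/-- The average of `t^m(u) E_{jl} t^n(u)^*` over the group intertwines the representations. -/
lemma integral_rep_intertwines (m n : ℕ) (j : Fin (m + 1)) (l : Fin (n + 1)) (v : SU2) :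
    rep m v * (Matrix.of fun i k => ∫ u, rep m u i j * star (rep n u k l) ∂haarSU2) =
      (Matrix.of fun i k => ∫ u, rep m u i j * star (rep n u k l) ∂haarSU2) * rep n v := by
  set A : Matrix (Fin (m + 1)) (Fin (n + 1)) ℂ :=
    Matrix.of fun i k => ∫ u, rep m u i j * star (rep n u k l) ∂haarSU2 with hA
  have key : A = rep m v * A * (rep n v)ᴴ := by
    ext i k
    -- Left invariance of Haar measure: substitute `v u` for `u` and expand both factors.
    have h := integral_mul_left_eq_self (μ := haarSU2)
      (fun u => rep m u i j * star (rep n u k l)) v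
    conv_lhs => rw [hA, Matrix.of_apply, ← h]
    have e : ∀ u, rep m (v * u) i j * star (rep n (v * u) k l) =
        ∑ q, ∑ p, rep m v i p * star (rep n v k q) * (rep m u p j * star (rep n u q l)) := by
      intro u
      rw [rep_mul, rep_mul, Matrix.mul_apply, Matrix.mul_apply, star_sum, Finset.sum_mul_sum,
        Finset.sum_comm]
      refine Finset.sum_congr rfl fun q _ => Finset.sum_congr rfl fun p _ => ?_
      rw [star_mul']
      ring
    simp only [e]
    rw [integral_finsetSum _ fun q _ => integrable_finsetSum _ fun p _ =>
      (integrable_rep_mul_conj m n p j q l).const_mul _]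
    rw [Matrix.mul_apply]
    refine Finset.sum_congr rfl fun q _ => ?_
    rw [integral_finsetSum _ fun p _ => (integrable_rep_mul_conj m n p j q l).const_mul _,
      Matrix.mul_apply, Finset.sum_mul]
    refine Finset.sum_congr rfl fun p _ => ?_
    rw [integral_const_mul, hA, Matrix.of_apply, Matrix.conjTranspose_apply]
    ring
  calc rep m v * A = rep m v * A * ((rep n v)ᴴ * rep n v) := by
        rw [conjTranspose_mul_rep, Matrix.mul_one]
    _ = A * rep n v := by rw [← Matrix.mul_assoc, ← key]

lemma integral_rep_mul_conj_of_ne {m n : ℕ} (hmn : m ≠ n) (i j : Fin (m + 1)) (k l : Fin (n + 1)) :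
    ∫ u, rep m u i j * star (rep n u k l) ∂haarSU2 = 0 :=
  congrFun (congrFun (intertwiner_eq_zero (integral_rep_intertwines m n j l) hmn) i) k

/-- The average is a scalar `c`; its trace is `(n+1) c`, and also `δ_{jl}` by unitarity. -/
lemma integral_rep_mul_conj (n : ℕ) (i j k l : Fin (n + 1)) :
    ∫ u, rep n u i j * star (rep n u k l) ∂haarSU2 =
      if i = k ∧ j = l then ((n : ℂ) + 1)⁻¹ else 0 := by
  set A : Matrix (Fin (n + 1)) (Fin (n + 1)) ℂ :=
    Matrix.of fun i k => ∫ u, rep n u i j * star (rep n u k l) ∂haarSU2 with hA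
  have h := intertwiner_eq_scalar (integral_rep_intertwines n n j l)
  rw [← hA] at h
  set c := A (Fin.last n) (Fin.last n)
  have htr : A.trace = if j = l then 1 else 0 := by
    simp only [Matrix.trace, Matrix.diag_apply, hA, Matrix.of_apply]
    rw [← integral_finsetSum _ fun i _ => integrable_rep_mul_conj n n i j i l]
    have e : ∀ u, ∑ i, rep n u i j * star (rep n u i l) = if j = l then 1 else 0 := by
      intro u
      have := congrFun (congrFun (conjTranspose_mul_rep n u) l) j
      rw [Matrix.mul_apply, Matrix.one_apply] at this
      simp only [eq_comm (a := l), Matrix.conjTranspose_apply] at this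
      rw [← this]
      exact Finset.sum_congr rfl fun i _ => mul_comm _ _
    rw [integral_congr_ae (Filter.Eventually.of_forall e)]
    simp
  have htr2 : A.trace = (n + 1) * c := by
    rw [h]; simp [Matrix.trace]
  have hn : (n : ℂ) + 1 ≠ 0 := by exact_mod_cast Nat.succ_ne_zero n
  have hik : ∫ u, rep n u i j * star (rep n u k l) ∂haarSU2 = if i = k then c else 0 := by
    have := congrFun (congrFun h i) k
    rw [hA, Matrix.of_apply] at this
    rw [this, Matrix.scalar_apply, Matrix.diagonal_apply]
  rw [hik]
  have hc : c = if j = l then ((n : ℂ) + 1)⁻¹ else 0 := by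
    rw [htr] at htr2
    split_ifs at htr2 ⊢
    · exact eq_inv_of_mul_eq_one_right htr2.symm
    · exact (mul_eq_zero.1 htr2.symm).resolve_left hn
  rw [hc, ite_and]

/-! ### Completeness of the matrix coefficients -/

section Recurrence

open Polynomial

/-- With `P = aX + c` and `Q = bX + d`, differentiate `P^(k+1) Q^j` and eliminate `b P` through `a Q
- b P = det u`. For `j = 0` the truncated `j - 1` is harmless, its term having the factor `j`. -/
lemma entry_zero_zero_mul_coef (k j m : ℕ) (u : Matrix (Fin 2) (Fin 2) ℂ) :
    ((k : ℂ) + j + 1) * (u 0 0 * coef k j m u) =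
      (m + 1) * coef (k + 1) j (m + 1) u + j * (u.det * coef k (j - 1) m u) := by
  have h : C ((k : ℂ) + j + 1) * (C (u 0 0) * ((C (u 0 0) * X + C (u 1 0)) ^ k *
      (C (u 0 1) * X + C (u 1 1)) ^ j)) = derivative ((C (u 0 0) * X + C (u 1 0)) ^ (k + 1) *
      (C (u 0 1) * X + C (u 1 1)) ^ j) + C (j : ℂ) * (C u.det * ((C (u 0 0) * X + C (u 1 0)) ^ k *
      (C (u 0 1) * X + C (u 1 1)) ^ (j - 1))) := by
    rw [Matrix.det_fin_two]
    rcases j with _ | j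
    · simp [derivative_pow]
      ring
    · simp [derivative_pow]
      ring
  have h' := congrArg (fun p => p.coeff m) h
  simp only [coeff_C_mul, coeff_add, coeff_derivative] at h'
  rw [coef, h', coef, coef]
  ring

/-- Swapping the columns exchanges the two linear factors and changes the sign of the determinant.
-/
lemma entry_zero_one_mul_coef (k j m : ℕ) (u : Matrix (Fin 2) (Fin 2) ℂ) :
    ((k : ℂ) + j + 1) * (u 0 1 * coef k j m u) =
      (m + 1) * coef k (j + 1) (m + 1) u - k * (u.det * coef (k - 1) j m u) := by
  have h := entry_zero_zero_mul_coef j k m (u.submatrix id (Equiv.swap 0 1))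
  have e : ∀ k j m, coef k j m (u.submatrix id (Equiv.swap 0 1)) = coef j k m u := by
    intro k j m
    rw [coef, coef, mul_comm]
    simp
  rw [e, e, e, Matrix.det_permute'] at h
  simp only [Matrix.submatrix_apply, id, Equiv.swap_apply_left, ne_eq, zero_ne_one,
    not_false_eq_true, Equiv.Perm.sign_swap, Units.val_neg, Units.val_one, Int.cast_neg,
    Int.cast_one] at h
  linear_combination h

lemma entry_one_zero_mul_coef (k j m : ℕ) (u : Matrix (Fin 2) (Fin 2) ℂ) :
    u 1 0 * coef k j m u = coef (k + 1) j m u - if m = 0 then 0 else u 0 0 * coef k j (m - 1) u := by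
  rw [coef, coef, pow_succ', mul_assoc, add_mul, mul_assoc (C (u 0 0)), coeff_add, coeff_C_mul,
    coeff_C_mul]
  rcases m with _ | m
  · simp
  · simp [coef, coeff_X_mul]

lemma entry_one_one_mul_coef (k j m : ℕ) (u : Matrix (Fin 2) (Fin 2) ℂ) :
    u 1 1 * coef k j m u = coef k (j + 1) m u - if m = 0 then 0 else u 0 1 * coef k j (m - 1) u := by
  rw [coef, coef, pow_succ', mul_left_comm, add_mul, mul_assoc (C (u 0 1)), coeff_add, coeff_C_mul,
    coeff_C_mul]
  rcases m with _ | m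
  · simp
  · simp [coef, coeff_X_mul]

lemma coef_eq_zero {k j m : ℕ} (h : k + j < m) (u : Matrix (Fin 2) (Fin 2) ℂ) :
    coef k j m u = 0 := by
  refine coeff_eq_zero_of_natDegree_lt (lt_of_le_of_lt ?_ h)
  refine natDegree_mul_le.trans (add_le_add ?_ ?_) <;>
  · refine natDegree_pow_le.trans ?_
    exact (Nat.mul_le_mul_left _ natDegree_linear_le).trans (mul_one _).le

end Recurrence

/-- The matrix coefficients as continuous functions on the group. -/
noncomputable def coefMap (k j m : ℕ) : C(SU2, ℂ) :=
  ⟨fun u => coef k j m u.1, (continuous_coef k j m).comp continuous_subtype_val⟩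

/-- The matrix entries as continuous functions on the group. -/
noncomputable def entryMap (i j : Fin 2) : C(SU2, ℂ) :=
  ⟨fun u => u.1 i j, continuous_subtype_val.matrix_elem i j⟩

/-- The span of the matrix coefficients. -/
noncomputable def coefSpan : Submodule ℂ C(SU2, ℂ) :=
  Submodule.span ℂ (Set.range fun p : ℕ × ℕ × ℕ => coefMap p.1 p.2.1 p.2.2)

lemma coefMap_mem_coefSpan (k j m : ℕ) : coefMap k j m ∈ coefSpan :=
  Submodule.subset_span ⟨(k, j, m), rfl⟩

lemma det_coe (u : SU2) : u.1.det = 1 := (Matrix.mem_specialUnitaryGroup_iff.1 u.2).2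

/-- Since `det u = 1`, the recurrences express the product linearly in matrix coefficients, in place
of the Clebsch–Gordan decomposition; second-row entries reduce to first-row ones. -/
lemma entryMap_mul_coefMap_mem (a b : Fin 2) (k j m : ℕ) :
    entryMap a b * coefMap k j m ∈ coefSpan := by
  have hkj : (k : ℂ) + j + 1 ≠ 0 := by exact_mod_cast Nat.succ_ne_zero (k + j)
  have h0 : ∀ m, entryMap 0 0 * coefMap k j m ∈ coefSpan := by
    intro m
    have e : entryMap 0 0 * coefMap k j m = ((k : ℂ) + j + 1)⁻¹ •
        (((m : ℂ) + 1) • coefMap (k + 1) j (m + 1) + (j : ℂ) • coefMap k (j - 1) m) := by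
      ext u
      have := entry_zero_zero_mul_coef k j m u.1
      rw [det_coe, one_mul] at this
      simp only [entryMap, coefMap, ContinuousMap.mul_apply, ContinuousMap.coe_mk,
        ContinuousMap.smul_apply, ContinuousMap.add_apply, smul_eq_mul]
      rw [← this, inv_mul_cancel_left₀ hkj]
    rw [e]
    exact coefSpan.smul_mem _ (coefSpan.add_mem (coefSpan.smul_mem _ (coefMap_mem_coefSpan _ _ _))
      (coefSpan.smul_mem _ (coefMap_mem_coefSpan _ _ _)))
  have h1 : ∀ m, entryMap 0 1 * coefMap k j m ∈ coefSpan := by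
    intro m
    have e : entryMap 0 1 * coefMap k j m = ((k : ℂ) + j + 1)⁻¹ •
        (((m : ℂ) + 1) • coefMap k (j + 1) (m + 1) - (k : ℂ) • coefMap (k - 1) j m) := by
      ext u
      have := entry_zero_one_mul_coef k j m u.1
      rw [det_coe, one_mul] at this
      simp only [entryMap, coefMap, ContinuousMap.mul_apply, ContinuousMap.coe_mk,
        ContinuousMap.smul_apply, ContinuousMap.sub_apply, smul_eq_mul]
      rw [← this, inv_mul_cancel_left₀ hkj]
    rw [e]
    exact coefSpan.smul_mem _ (coefSpan.sub_mem (coefSpan.smul_mem _ (coefMap_mem_coefSpan _ _ _))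
      (coefSpan.smul_mem _ (coefMap_mem_coefSpan _ _ _)))
  have h2 : entryMap 1 0 * coefMap k j m ∈ coefSpan := by
    have e : entryMap 1 0 * coefMap k j m = coefMap (k + 1) j m -
        if m = 0 then 0 else entryMap 0 0 * coefMap k j (m - 1) := by
      ext u
      refine (entry_one_zero_mul_coef k j m u.1).trans ?_
      split_ifs <;> rfl
    rw [e]
    refine coefSpan.sub_mem (coefMap_mem_coefSpan _ _ _) ?_
    split_ifs
    exacts [coefSpan.zero_mem, h0 _]
  have h3 : entryMap 1 1 * coefMap k j m ∈ coefSpan := by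
    have e : entryMap 1 1 * coefMap k j m = coefMap k (j + 1) m -
        if m = 0 then 0 else entryMap 0 1 * coefMap k j (m - 1) := by
      ext u
      refine (entry_one_one_mul_coef k j m u.1).trans ?_
      split_ifs <;> rfl
    rw [e]
    refine coefSpan.sub_mem (coefMap_mem_coefSpan _ _ _) ?_
    split_ifs
    exacts [coefSpan.zero_mem, h1 _]
  fin_cases a <;> fin_cases b
  exacts [h0 m, h1 m, h2, h3]

lemma entryMap_mul_mem (a b : Fin 2) {g : C(SU2, ℂ)} (hg : g ∈ coefSpan) :
    entryMap a b * g ∈ coefSpan := by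
  have : coefSpan ≤ coefSpan.comap (LinearMap.mulLeft ℂ (entryMap a b)) := by
    refine Submodule.span_le.2 ?_
    rintro _ ⟨p, rfl⟩
    exact entryMap_mul_coefMap_mem _ _ _ _ _
  exact this hg

/-- The set of matrix entries. -/
def entrySet : Set C(SU2, ℂ) := Set.range fun p : Fin 2 × Fin 2 => entryMap p.1 p.2

lemma one_mem_coefSpan : (1 : C(SU2, ℂ)) ∈ coefSpan := by
  convert coefMap_mem_coefSpan 0 0 0
  ext u
  simp [coefMap, coef]

lemma adjoin_entrySet_le : Subalgebra.toSubmodule (Algebra.adjoin ℂ entrySet) ≤ coefSpan := by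
  rw [Algebra.adjoin_eq_span, Submodule.span_le]
  intro g hg
  induction hg using Submonoid.closure_induction_left with
  | one => exact one_mem_coefSpan
  | mul_left x hx y _ ih =>
    obtain ⟨p, rfl⟩ := hx
    exact entryMap_mul_mem _ _ ih

lemma star_coe_eq_adjugate (u : SU2) : star u.1 = u.1.adjugate := by
  have h : star u.1 * u.1 = 1 :=
    Matrix.mem_unitaryGroup_iff'.1 (Matrix.mem_specialUnitaryGroup_iff.1 u.2).1
  calc star u.1 = star u.1 * (u.1 * u.1.adjugate) := by
        rw [Matrix.mul_adjugate, det_coe, one_smul, mul_one]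
    _ = u.1.adjugate := by rw [← mul_assoc, h, one_mul]

/-- On SU(2) the adjoint is the adjugate, so a conjugated entry is plus or minus another entry. -/
lemma star_entryMap_mem (a b : Fin 2) : star (entryMap a b) ∈ Algebra.adjoin ℂ entrySet := by
  have hmem : ∀ a b, entryMap a b ∈ Algebra.adjoin ℂ entrySet := fun a b =>
    Algebra.subset_adjoin ⟨(a, b), rfl⟩
  have h : ∀ u : SU2, star (u.1 a b) = u.1.adjugate b a := by
    intro u
    rw [← star_coe_eq_adjugate, Matrix.star_apply]
  simp only [Matrix.adjugate_fin_two] at h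
  fin_cases a <;> fin_cases b
  · convert hmem 1 1
    ext u; simpa [entryMap] using h u
  · convert neg_mem (hmem 1 0)
    ext u; simpa [entryMap] using h u
  · convert neg_mem (hmem 0 1)
    ext u; simpa [entryMap] using h u
  · convert hmem 0 0
    ext u; simpa [entryMap] using h u

/-- The algebra generated by the matrix entries. -/
noncomputable def entryAlgebra : StarSubalgebra ℂ C(SU2, ℂ) where
  toSubalgebra := Algebra.adjoin ℂ entrySet
  star_mem' := by
    change Algebra.adjoin ℂ entrySet ≤ star (Algebra.adjoin ℂ entrySet)
    refine Algebra.adjoin_le ?_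
    rintro _ ⟨p, rfl⟩
    exact star_entryMap_mem p.1 p.2

lemma entryAlgebra_separatesPoints : entryAlgebra.SeparatesPoints := by
  intro u v huv
  have : ∃ i j, u.1 i j ≠ v.1 i j := by
    by_contra! h
    exact huv (Subtype.ext (Matrix.ext h))
  obtain ⟨i, j, hij⟩ := this
  exact ⟨_, ⟨entryMap i j, Algebra.subset_adjoin ⟨(i, j), rfl⟩, rfl⟩, hij⟩

lemma coefSpan_topologicalClosure : coefSpan.topologicalClosure = ⊤ := by
  have h := ContinuousMap.starSubalgebra_topologicalClosure_eq_top_of_separatesPoints entryAlgebra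
    entryAlgebra_separatesPoints
  have h2 : (Subalgebra.toSubmodule (Algebra.adjoin ℂ entrySet)).topologicalClosure = ⊤ :=
    congr_arg (Subalgebra.toSubmodule <| StarSubalgebra.toSubalgebra ·) h
  exact top_le_iff.1 (h2 ▸ Submodule.topologicalClosure_mono adjoin_entrySet_le)

/-! ### The Plancherel identity -/

/-- The index set of the matrix coefficients. -/
abbrev CoefIndex : Type := Σ n : ℕ, Fin (n + 1) × Fin (n + 1)

/-- The normalized matrix coefficient `√(n + 1) t^n_{ij}`. -/
noncomputable def normalizedRep (p : CoefIndex) : C(SU2, ℂ) :=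
  ⟨fun u => (Real.sqrt (p.1 + 1) : ℂ) * rep p.1 u p.2.1 p.2.2,
    continuous_const.mul (continuous_rep _ _ _)⟩

lemma coefSpan_le : coefSpan ≤ Submodule.span ℂ (Set.range normalizedRep) := by
  refine Submodule.span_le.2 ?_
  rintro _ ⟨⟨k, j, m⟩, rfl⟩
  by_cases hm : k + j < m
  · have : coefMap k j m = 0 := by
      ext u
      exact coef_eq_zero hm _
    simp only [this]
    exact Submodule.zero_mem _
  · let m' : Fin (k + j + 1) := ⟨m, by omega⟩
    let k' : Fin (k + j + 1) := ⟨k, by omega⟩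
    have hs : (Real.sqrt ((k + j : ℕ) + 1) : ℂ) ≠ 0 :=
      Complex.ofReal_ne_zero.2 (Real.sqrt_pos.2 (by positivity)).ne'
    have : coefMap k j m = ((Real.sqrt ((k + j : ℕ) + 1) : ℂ)⁻¹ *
        ((normFactor (k + j) m' : ℂ)⁻¹ * normFactor (k + j) k')) •
          normalizedRep ⟨k + j, (m', k')⟩ := by
      ext u
      simp only [coefMap, normalizedRep, ContinuousMap.coe_mk, ContinuousMap.smul_apply,
        smul_eq_mul, rep_eq_coef]
      have e : k + j - (k' : ℕ) = j := by simp [k']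
      rw [e]
      field_simp [hs, normFactor_ne_zero (k + j) m', normFactor_ne_zero (k + j) k']
      rfl
    simp only [this]
    exact Submodule.smul_mem _ _ (Submodule.subset_span ⟨_, rfl⟩)

/-- The normalized matrix coefficients in `L²`. -/
noncomputable abbrev normalizedRepLp (p : CoefIndex) : Lp ℂ 2 haarSU2 :=
  ContinuousMap.toLp (E := ℂ) 2 haarSU2 ℂ (normalizedRep p)

instance instRegularHaarSU2 : haarSU2.Regular :=
  inferInstanceAs (Measure.haarMeasure ⊤).Regular

/-- Uniform density passes to `L²`, in which continuous functions are dense. -/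
lemma span_normalizedRepLp :
    (Submodule.span ℂ (Set.range normalizedRepLp)).topologicalClosure = ⊤ := by
  have h : (Submodule.span ℂ (Set.range normalizedRep)).topologicalClosure = ⊤ :=
    top_le_iff.1 (coefSpan_topologicalClosure ▸ Submodule.topologicalClosure_mono coefSpan_le)
  convert! (ContinuousMap.toLp_denseRange ℂ haarSU2 ℂ
    (p := 2) ENNReal.ofNat_ne_top).topologicalClosure_map_submodule h
  rw [Submodule.map_span]
  unfold normalizedRepLp
  rw [Set.range_comp']
  simp only [ContinuousLinearMap.coe_coe]

lemma orthonormal_normalizedRepLp : Orthonormal ℂ normalizedRepLp := by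
  rw [orthonormal_iff_ite]
  rintro ⟨m, i, j⟩ ⟨n, k, l⟩
  rw [ContinuousMap.inner_toLp]
  have e : ∀ u, normalizedRep ⟨n, k, l⟩ u * (starRingEnd ℂ) (normalizedRep ⟨m, i, j⟩ u) =
      ((Real.sqrt (n + 1) : ℂ) * Real.sqrt (m + 1)) * (rep n u k l * star (rep m u i j)) := by
    intro u
    simp only [normalizedRep, ContinuousMap.coe_mk, map_mul, Complex.conj_ofReal, RCLike.star_def]
    ring
  simp only [e]
  rw [integral_const_mul]
  by_cases hmn : m = n
  · subst hmn
    rw [integral_rep_mul_conj]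
    have hs : (Real.sqrt (m + 1) : ℂ) * Real.sqrt (m + 1) = m + 1 := by
      rw [← Complex.ofReal_mul, Real.mul_self_sqrt (by positivity)]
      simp
    have hn : (m : ℂ) + 1 ≠ 0 := by exact_mod_cast Nat.succ_ne_zero m
    rw [hs]
    by_cases h : k = i ∧ l = j
    · obtain ⟨rfl, rfl⟩ := h
      simp [hn]
    · rw [if_neg h, if_neg, mul_zero]
      intro h'
      simp only [Sigma.mk.injEq, heq_eq_eq, true_and, Prod.mk.injEq] at h'
      exact h ⟨h'.1.symm, h'.2.symm⟩
  · rw [integral_rep_mul_conj_of_ne (Ne.symm hmn), mul_zero, if_neg]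
    intro h
    exact hmn (congrArg Sigma.fst h)

/-- The Hilbert basis of `L²` formed by the normalized matrix coefficients. -/
noncomputable def repBasis : HilbertBasis CoefIndex ℂ (Lp ℂ 2 haarSU2) :=
  HilbertBasis.mk orthonormal_normalizedRepLp span_normalizedRepLp.ge

lemma hsNorm_sq {n : ℕ} (A : Matrix (Fin n) (Fin n) ℂ) :
    hsNorm A ^ 2 = ∑ p : Fin n × Fin n, ‖A p.1 p.2‖ ^ 2 := by
  have h : (A * Aᴴ).trace.re = ∑ p : Fin n × Fin n, ‖A p.1 p.2‖ ^ 2 := by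
    simp only [Matrix.trace, Matrix.diag_apply, Matrix.mul_apply, Matrix.conjTranspose_apply,
      Complex.re_sum, Fintype.sum_prod_type]
    refine Finset.sum_congr rfl fun i _ => Finset.sum_congr rfl fun j _ => ?_
    rw [RCLike.star_def, Complex.mul_conj, Complex.normSq_eq_norm_sq, Complex.ofReal_re]
  rw [hsNorm, h, Real.sq_sqrt (by positivity)]

lemma inner_repBasis {f : SU2 → ℂ} (hf : MemLp f 2 haarSU2) (p : CoefIndex) :
    inner ℂ (repBasis p) (hf.toLp f) =
      (Real.sqrt (p.1 + 1) : ℂ) * fourierCoeff f p.1 p.2.2 p.2.1 := by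
  rw [repBasis, HilbertBasis.coe_mk, L2.inner_def]
  have e : (fun u => inner ℂ (normalizedRepLp p u) (hf.toLp f u)) =ᵐ[haarSU2] fun u =>
      (Real.sqrt (p.1 + 1) : ℂ) * (f u * (rep p.1 u)ᴴ p.2.2 p.2.1) := by
    filter_upwards [hf.coeFn_toLp, ContinuousMap.coeFn_toLp (𝕜 := ℂ) (p := 2) haarSU2 (normalizedRep p)]
      with u h1 h2
    rw [h1, h2]
    simp [normalizedRep, Matrix.conjTranspose_apply, RCLike.inner_apply]
    ring
  rw [integral_congr_ae e, integral_const_mul]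
  rfl

theorem plancherel {f : SU2 → ℂ} (hf : MemLp f 2 haarSU2) :
    HasSum (fun n : ℕ => ((n : ℝ) + 1) * hsNorm (fourierCoeff f n) ^ 2)
      ((eLpNorm f 2 haarSU2).toReal ^ 2) := by
  have h := Complex.hasSum_iff _ _ |>.1 (repBasis.hasSum_inner_mul_inner (hf.toLp f) (hf.toLp f))
  have h1 := h.1
  rw [← RCLike.re_eq_complex_re, inner_self_eq_norm_sq, Lp.norm_toLp] at h1
  have h2 := h1.sigma fun n => hasSum_fintype _
  convert h2 using 2 with n
  -- The Fourier coefficient uses `t^*`, so the basis index `(i, j)` meets the entry `(j, i)`; hence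
  -- the swap.
  rw [hsNorm_sq, Finset.mul_sum, ← (Equiv.prodComm (Fin (n + 1)) (Fin (n + 1))).sum_comp]
  refine Finset.sum_congr rfl fun q _ => ?_
  rw [← inner_conj_symm, inner_repBasis, RCLike.re_eq_complex_re,
    ← Complex.normSq_eq_conj_mul_self, Complex.ofReal_re, Complex.normSq_eq_norm_sq, norm_mul, mul_pow, Complex.norm_real,
    Real.norm_of_nonneg (Real.sqrt_nonneg _), Real.sq_sqrt (by positivity)]
  rfl

/-! ### Interpolation -/

section Interpolation

/-- The contribution of large values of the function; `p > 1` gives convergence at `t = 0`. -/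
lemma lintegral_rpow_truncated_below {p g C : ℝ} (hp : 1 < p) (hg : 0 ≤ g) (hC : 0 ≤ C) :
    ∫⁻ t in Set.Ioi (0 : ℝ), (if t < g then ENNReal.ofReal (C * t ^ (p - 2) * g) else 0) =
      ENNReal.ofReal (C / (p - 1) * g ^ p) := by
  have e : ∫⁻ t in Set.Ioi (0 : ℝ), (if t < g then ENNReal.ofReal (C * t ^ (p - 2) * g) else 0) =
      ∫⁻ t in Set.Ioo 0 g, ENNReal.ofReal (C * t ^ (p - 2) * g) := by
    have : Set.Ioo 0 g = Set.Iio g ∩ Set.Ioi 0 := by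
      ext t; simp [and_comm]
    rw [this, ← Measure.restrict_restrict measurableSet_Iio,
      ← lintegral_indicator measurableSet_Iio]
    rfl
  have hint : IntervalIntegrable (fun t : ℝ => C * t ^ (p - 2) * g) volume 0 g :=
    ((intervalIntegral.intervalIntegrable_rpow' (by linarith)).const_mul C).mul_const g
  rw [e, setLIntegral_congr Ioo_ae_eq_Ioc, ← ofReal_integral_eq_lintegral_ofReal
    ((intervalIntegrable_iff_integrableOn_Ioc_of_le hg).1 hint),
    ← intervalIntegral.integral_of_le hg]
  · rw [intervalIntegral.integral_mul_const, intervalIntegral.integral_const_mul,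
      integral_rpow (Or.inl (by linarith)), Real.zero_rpow (by linarith)]
    congr 1
    rcases hg.eq_or_lt with rfl | hg
    · simp [Real.zero_rpow (show p ≠ 0 by linarith)]
    · rw [show p - 2 + 1 = p - 1 by ring, Real.rpow_sub_one hg.ne']
      field_simp
      ring
  · filter_upwards [ae_restrict_mem measurableSet_Ioc] with t ht
    have := ht.1.le
    simp only [Pi.zero_apply]
    positivity

/-- The contribution of small values; `p < 2` gives convergence at infinity. -/
lemma lintegral_rpow_truncated_above {p g D : ℝ} (hp : p < 2) (hg : 0 ≤ g) (hD : 0 ≤ D) :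
    ∫⁻ t in Set.Ioi (0 : ℝ), (if t < g then 0 else ENNReal.ofReal (D * t ^ (p - 3) * g ^ 2)) ≤
      ENNReal.ofReal (D / (2 - p) * g ^ p) := by
  rcases hg.eq_or_lt with rfl | hg
  · simp
  have e : ∫⁻ t in Set.Ioi (0 : ℝ),
      (if t < g then 0 else ENNReal.ofReal (D * t ^ (p - 3) * g ^ 2)) =
      ∫⁻ t in Set.Ici g, ENNReal.ofReal (D * t ^ (p - 3) * g ^ 2) := by
    have : Set.Ici g = Set.Ici g ∩ Set.Ioi 0 :=
      (Set.inter_eq_left.2 fun t ht => hg.trans_le ht).symm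
    rw [this, ← Measure.restrict_restrict measurableSet_Ici,
      ← lintegral_indicator measurableSet_Ici]
    refine lintegral_congr fun t => ?_
    by_cases h : t < g
    · simp [h]
    · simp [h, not_lt.1 h]
  have hint : IntegrableOn (fun t : ℝ => D * t ^ (p - 3) * g ^ 2) (Set.Ioi g) :=
    ((integrableOn_Ioi_rpow_of_lt (by linarith) hg).const_mul D).mul_const _
  rw [e, setLIntegral_congr Ioi_ae_eq_Ici.symm, ← ofReal_integral_eq_lintegral_ofReal hint]
  · rw [integral_mul_const, integral_const_mul, integral_Ioi_rpow_of_lt (by linarith) hg]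
    refine le_of_eq (congrArg _ ?_)
    have h1 : g ^ p = g ^ (p - 3 + 1) * g ^ 2 := by
      rw [← Real.rpow_natCast g 2, ← Real.rpow_add hg]
      congr 1
      push_cast
      ring
    have h2 : 2 - p ≠ 0 := by linarith
    have h3 : p - 3 + 1 ≠ 0 := by linarith
    rw [h1]
    field_simp
    ring
  · filter_upwards [ae_restrict_mem measurableSet_Ioi] with t ht
    have := hg.trans ht
    simp only [Pi.zero_apply]
    positivity

/-- The integration step of Marcinkiewicz interpolation between weak type `(1, 1)` and strong type
`(2, 2)`. -/
theorem lintegral_rpow_le_of_weak_type {X Ω : Type*} [MeasurableSpace X] [MeasurableSpace Ω]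
    {ν : Measure X} {μ : Measure Ω} [SFinite μ] {a : X → ℝ} (ha : Measurable a) (ha0 : ∀ x, 0 ≤ a x)
    {g : Ω → ℝ} (hg : Measurable g) (hg0 : ∀ u, 0 ≤ g u) {p C D : ℝ} (hp1 : 1 < p) (hp2 : p < 2)
    (hC : 0 ≤ C) (hD : 0 ≤ D)
    (h : ∀ t, 0 < t → ν {x | t < a x} ≤
      ENNReal.ofReal (C / t) * ∫⁻ u in {u | t < g u}, ENNReal.ofReal (g u) ∂μ +
      ENNReal.ofReal (D / t ^ 2) * ∫⁻ u in {u | t < g u}ᶜ, ENNReal.ofReal (g u ^ 2) ∂μ) :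
    ∫⁻ x, ENNReal.ofReal (a x ^ p) ∂ν ≤
      ENNReal.ofReal (p * (C / (p - 1) + D / (2 - p))) * ∫⁻ u, ENNReal.ofReal (g u ^ p) ∂μ := by
  have hp1' : 0 < p - 1 := by linarith
  have hp2' : 0 < 2 - p := by linarith
  rw [lintegral_rpow_eq_lintegral_meas_lt_mul ν (Filter.Eventually.of_forall ha0) ha.aemeasurable
    (by linarith), ENNReal.ofReal_mul (by linarith), mul_assoc]
  refine mul_le_mul_right ?_ _
  -- After the layer-cake formula, `F` and `G` are the integrands of the two terms of `h` multiplied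
  -- by `t^(p-1)`; Tonelli then lets the `t`-integral be computed first.
  set F : ℝ → Ω → ℝ≥0∞ := fun t u => if t < g u then ENNReal.ofReal (C * t ^ (p - 2) * g u) else 0
  set G : ℝ → Ω → ℝ≥0∞ := fun t u =>
    if t < g u then 0 else ENNReal.ofReal (D * t ^ (p - 3) * g u ^ 2)
  have hset : MeasurableSet {q : ℝ × Ω | q.1 < g q.2} :=
    measurableSet_lt measurable_fst (hg.comp measurable_snd)
  have hF : Measurable (Function.uncurry F) :=
    Measurable.ite hset (by fun_prop) measurable_const
  have hG : Measurable (Function.uncurry G) :=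
    Measurable.ite hset measurable_const (by fun_prop)
  have hF1 : Measurable fun t => ∫⁻ u, F t u ∂μ := hF.lintegral_prod_right'
  have hF2 : Measurable fun u => ∫⁻ t in Set.Ioi 0, F t u := hF.lintegral_prod_left'
  have hsett : ∀ t, MeasurableSet {u | t < g u} := fun t => measurableSet_lt measurable_const hg
  have key : ∀ t ∈ Set.Ioi (0 : ℝ), ν {x | t < a x} * ENNReal.ofReal (t ^ (p - 1)) ≤
      ∫⁻ u, F t u ∂μ + ∫⁻ u, G t u ∂μ := by
    intro t ht
    have ht : 0 < t := ht
    have e1 : ENNReal.ofReal (C / t) * (∫⁻ u in {u | t < g u}, ENNReal.ofReal (g u) ∂μ) *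
        ENNReal.ofReal (t ^ (p - 1)) = ∫⁻ u, F t u ∂μ := by
      rw [mul_right_comm, ← ENNReal.ofReal_mul (by positivity),
        ← lintegral_const_mul _ (by fun_prop), ← lintegral_indicator (hsett t)]
      refine lintegral_congr fun u => ?_
      by_cases hu : t < g u
      · have : (t : ℝ) ^ (p - 1) = t ^ (p - 2) * t := by
          rw [← Real.rpow_add_one ht.ne']; congr 1; ring
        simp only [Set.indicator, Set.mem_ofPred_eq, hu, if_true, F]
        rw [← ENNReal.ofReal_mul (by positivity), this]
        congr 1
        field_simp
      · simp [hu, F]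
    have e2 : ENNReal.ofReal (D / t ^ 2) * (∫⁻ u in {u | t < g u}ᶜ, ENNReal.ofReal (g u ^ 2) ∂μ) *
        ENNReal.ofReal (t ^ (p - 1)) = ∫⁻ u, G t u ∂μ := by
      rw [mul_right_comm, ← ENNReal.ofReal_mul (by positivity),
        ← lintegral_const_mul _ (by fun_prop), ← lintegral_indicator (hsett t).compl]
      refine lintegral_congr fun u => ?_
      by_cases hu : t < g u
      · simp [hu, G]
      · have : (t : ℝ) ^ (p - 1) = t ^ (p - 3) * t ^ 2 := by
          rw [← Real.rpow_natCast t 2, ← Real.rpow_add ht]; congr 1; push_cast; ring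
        simp only [Set.indicator, Set.mem_compl_iff, Set.mem_ofPred_eq, hu, not_false_eq_true,
          if_true, if_false, G]
        rw [← ENNReal.ofReal_mul (by positivity), this]
        congr 1
        field_simp
    rw [← e1, ← e2, ← add_mul]
    exact mul_le_mul_left (h t ht) _
  calc ∫⁻ t in Set.Ioi 0, ν {x | t < a x} * ENNReal.ofReal (t ^ (p - 1))
      ≤ ∫⁻ t in Set.Ioi 0, (∫⁻ u, F t u ∂μ + ∫⁻ u, G t u ∂μ) :=
        setLIntegral_mono' measurableSet_Ioi key
    _ = ∫⁻ u, (∫⁻ t in Set.Ioi 0, F t u) + (∫⁻ t in Set.Ioi 0, G t u) ∂μ := by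
        rw [lintegral_add_left hF1,
          lintegral_lintegral_swap hF.aemeasurable, lintegral_lintegral_swap hG.aemeasurable,
          lintegral_add_left hF2]
    _ ≤ ∫⁻ u, ENNReal.ofReal (C / (p - 1) + D / (2 - p)) * ENNReal.ofReal (g u ^ p) ∂μ := by
        refine lintegral_mono fun u => ?_
        have h0 := Real.rpow_nonneg (hg0 u) p
        refine (add_le_add (lintegral_rpow_truncated_below hp1 (hg0 u) hC).le
          (lintegral_rpow_truncated_above hp2 (hg0 u) hD)).trans ?_
        rw [← ENNReal.ofReal_add (by positivity) (by positivity),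
          ← ENNReal.ofReal_mul (by positivity), add_mul]
    _ = _ := lintegral_const_mul _ (by fun_prop)

/-- The measure on `ℕ` giving mass `(n + 1) ^ (-4)` to `n`. -/
noncomputable def weight : Measure ℕ :=
  Measure.sum fun n : ℕ => ENNReal.ofReal ((((n : ℝ) + 1) ^ 4)⁻¹) • Measure.dirac n

lemma lintegral_weight (g : ℕ → ℝ≥0∞) :
    ∫⁻ n, g n ∂weight = ∑' n : ℕ, ENNReal.ofReal ((((n : ℝ) + 1) ^ 4)⁻¹) * g n := by
  simp [weight, lintegral_sum_measure, lintegral_smul_measure]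

/-- A discrete form of integrating `x^(-4)`, with a non-sharp constant, made to telescope. -/
lemma inv_pow_four_le (x : ℝ) (hx : 1 ≤ x) : (x ^ 4)⁻¹ ≤ 3 * ((x ^ 3)⁻¹ - ((x + 1) ^ 3)⁻¹) := by
  have h0 : 0 < x := by linarith
  have e : 3 * ((x ^ 3)⁻¹ - ((x + 1) ^ 3)⁻¹) - (x ^ 4)⁻¹ =
      (8 * x ^ 3 + 6 * x ^ 2 - 1) / (x ^ 4 * (x + 1) ^ 3) := by
    field_simp
    ring
  have h2 : 0 ≤ 8 * x ^ 3 + 6 * x ^ 2 - 1 := by nlinarith [pow_pos h0 3]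
  rw [← sub_nonneg, e]
  positivity

lemma weight_tail_le {R : ℝ} (hR : 0 < R) :
    weight {n | R < ((n : ℝ) + 1) ^ 3} ≤ ENNReal.ofReal (3 / R) := by
  -- Capping at `R⁻¹` makes the telescoping sum at most `3 R⁻¹` without locating the first index of
  -- the tail.
  set g : ℕ → ℝ := fun n => min R⁻¹ (((n : ℝ) + 1) ^ 3)⁻¹ with hg
  set b : ℕ → ℝ := fun n => if R < ((n : ℝ) + 1) ^ 3 then (((n : ℝ) + 1) ^ 4)⁻¹ else 0 with hb
  have hb0 : ∀ n, 0 ≤ b n := by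
    intro n
    simp only [hb]
    split_ifs <;> positivity
  have hbg : ∀ n, b n ≤ 3 * (g n - g (n + 1)) := by
    intro n
    have h1 : (((n : ℝ) + 1 + 1) ^ 3)⁻¹ ≤ (((n : ℝ) + 1) ^ 3)⁻¹ := by gcongr; linarith
    simp only [hb, hg, Nat.cast_add, Nat.cast_one]
    split_ifs with h
    · have h2 : (((n : ℝ) + 1) ^ 3)⁻¹ ≤ R⁻¹ := inv_anti₀ hR h.le
      rw [min_eq_right h2, min_eq_right (h1.trans h2)]
      exact inv_pow_four_le _ (by simp)
    · linarith [min_le_min_left R⁻¹ h1]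
  have e : weight {n | R < ((n : ℝ) + 1) ^ 3} = ∑' n, ENNReal.ofReal (b n) := by
    rw [← lintegral_indicator_one (MeasurableSet.of_discrete), lintegral_weight]
    refine tsum_congr fun n => ?_
    simp only [Set.indicator, Set.mem_ofPred_eq, hb, Pi.one_apply]
    split_ifs <;> simp
  rw [e]
  refine ENNReal.tsum_le_of_sum_range_le fun N => ?_
  rw [← ENNReal.ofReal_sum_of_nonneg fun n _ => hb0 n]
  refine ENNReal.ofReal_le_ofReal ?_
  calc ∑ n ∈ Finset.range N, b n ≤ ∑ n ∈ Finset.range N, 3 * (g n - g (n + 1)) :=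
        Finset.sum_le_sum fun n _ => hbg n
    _ = 3 * (g 0 - g N) := by rw [← Finset.mul_sum, Finset.sum_range_sub']
    _ ≤ 3 * R⁻¹ := by
        have h1 : g 0 ≤ R⁻¹ := min_le_left _ _
        have h2 : 0 ≤ g N := by positivity
        linarith
    _ = 3 / R := rfl

end Interpolation

/-! ### The Hardy–Littlewood inequality -/

/-- A matrix as a vector of the Euclidean space of its entries. -/
noncomputable def matrixVec {n : ℕ} (A : Matrix (Fin n) (Fin n) ℂ) :
    EuclideanSpace ℂ (Fin n × Fin n) :=
  WithLp.toLp 2 fun p => A p.1 p.2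

lemma norm_matrixVec {n : ℕ} (A : Matrix (Fin n) (Fin n) ℂ) : ‖matrixVec A‖ = hsNorm A := by
  rw [EuclideanSpace.norm_eq, ← Real.sqrt_sq (show 0 ≤ hsNorm A from Real.sqrt_nonneg _), hsNorm_sq]
  rfl

lemma hsNorm_nonneg {n : ℕ} (A : Matrix (Fin n) (Fin n) ℂ) : 0 ≤ hsNorm A := Real.sqrt_nonneg _

lemma hsNorm_add_le {n : ℕ} (A B : Matrix (Fin n) (Fin n) ℂ) :
    hsNorm (A + B) ≤ hsNorm A + hsNorm B := by
  simp only [← norm_matrixVec]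
  exact norm_add_le (matrixVec A) (matrixVec B)

lemma hsNorm_rep_conjTranspose (n : ℕ) (u : SU2) : hsNorm (rep n u)ᴴ = Real.sqrt (n + 1) := by
  rw [hsNorm, Matrix.conjTranspose_conjTranspose, conjTranspose_mul_rep]
  simp

lemma continuous_matrixVec_rep (n : ℕ) : Continuous fun u : SU2 => matrixVec (rep n u)ᴴ := by
  refine (PiLp.continuous_toLp 2 _).comp (continuous_pi fun p => ?_)
  exact (continuous_rep n p.2 p.1).star

lemma integrable_smul_matrixVec {f : SU2 → ℂ} (hf : Integrable f haarSU2) (n : ℕ) :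
    Integrable (fun u => f u • matrixVec (rep n u)ᴴ) haarSU2 := by
  refine (hf.norm.mul_const (Real.sqrt (n + 1))).mono'
    (hf.1.smul (continuous_matrixVec_rep n).aestronglyMeasurable) ?_
  filter_upwards with u
  rw [norm_smul, norm_matrixVec, hsNorm_rep_conjTranspose]

lemma matrixVec_fourierCoeff {f : SU2 → ℂ} (hf : Integrable f haarSU2) (n : ℕ) :
    matrixVec (fourierCoeff f n) = ∫ u, f u • matrixVec (rep n u)ᴴ ∂haarSU2 := by
  ext p
  exact (EuclideanSpace.proj (𝕜 := ℂ) p).integral_comp_comm (integrable_smul_matrixVec hf n)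

lemma fourierCoeff_add {f g : SU2 → ℂ} (hf : Integrable f haarSU2) (hg : Integrable g haarSU2)
    (n : ℕ) : fourierCoeff (f + g) n = fourierCoeff f n + fourierCoeff g n := by
  have h : matrixVec (fourierCoeff (f + g) n) =
      matrixVec (fourierCoeff f n) + matrixVec (fourierCoeff g n) := by
    rw [matrixVec_fourierCoeff (hf.add hg), matrixVec_fourierCoeff hf, matrixVec_fourierCoeff hg,
      ← integral_add (integrable_smul_matrixVec hf n) (integrable_smul_matrixVec hg n)]
    simp only [Pi.add_apply, add_smul]
  ext i j
  exact congrArg (fun v : EuclideanSpace ℂ (Fin (n + 1) × Fin (n + 1)) => v (i, j)) h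

/-- Minkowski's integral inequality; the unitary `t^n(u)^*` has Hilbert–Schmidt norm `√(n+1)`. -/
lemma hsNorm_fourierCoeff_le {f : SU2 → ℂ} (hf : Integrable f haarSU2) (n : ℕ) :
    hsNorm (fourierCoeff f n) ≤ Real.sqrt (n + 1) * ∫ u, ‖f u‖ ∂haarSU2 := by
  rw [← norm_matrixVec, matrixVec_fourierCoeff hf, mul_comm, ← integral_mul_const]
  refine (norm_integral_le_integral_norm _).trans (le_of_eq ?_)
  simp only [norm_smul, norm_matrixVec, hsNorm_rep_conjTranspose]

lemma fourierCoeff_congr {f g : SU2 → ℂ} (h : f =ᵐ[haarSU2] g) (n : ℕ) :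
    fourierCoeff f n = fourierCoeff g n := by
  ext i j
  refine integral_congr_ae ?_
  filter_upwards [h] with u hu
  rw [hu]

/-- The sequence `(n + 1) ^ (5 / 2) ‖f̂(n)‖`. -/
noncomputable def scaledNorm (f : SU2 → ℂ) (n : ℕ) : ℝ :=
  ((n : ℝ) + 1) ^ (5 / 2 : ℝ) * hsNorm (fourierCoeff f n)

lemma scaledNorm_nonneg (f : SU2 → ℂ) (n : ℕ) : 0 ≤ scaledNorm f n :=
  mul_nonneg (by positivity) (hsNorm_nonneg _)

lemma weight_scaledNorm_le_of_integrable {f : SU2 → ℂ} (hf : Integrable f haarSU2) {t : ℝ}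
    (ht : 0 < t) : weight {n | t < scaledNorm f n} ≤
      ENNReal.ofReal (3 / t) * ∫⁻ u, ENNReal.ofReal ‖f u‖ ∂haarSU2 := by
  set F := ∫ u, ‖f u‖ ∂haarSU2 with hF
  have hF0 : 0 ≤ F := integral_nonneg fun u => norm_nonneg _
  rw [← ofReal_integral_eq_lintegral_ofReal hf.norm
    (Filter.Eventually.of_forall fun u => norm_nonneg _), ← ENNReal.ofReal_mul (by positivity)]
  have h : ∀ n, scaledNorm f n ≤ ((n : ℝ) + 1) ^ 3 * F := by
    intro n
    have hn : (0 : ℝ) < n + 1 := by positivity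
    have e : ((n : ℝ) + 1) ^ 3 = ((n : ℝ) + 1) ^ (5 / 2 : ℝ) * Real.sqrt (n + 1) := by
      rw [Real.sqrt_eq_rpow, ← Real.rpow_add hn, ← Real.rpow_natCast]
      norm_num
    rw [e, mul_assoc]
    exact mul_le_mul_of_nonneg_left (hsNorm_fourierCoeff_le hf n) (by positivity)
  -- Otherwise the superlevel set lies in the tail with `R = t / ‖f‖₁`, which needs `‖f‖₁ ≠ 0`.
  rcases hF0.eq_or_lt with h0 | h0
  · have : {n | t < scaledNorm f n} = ∅ := by
      ext n
      simp only [Set.mem_ofPred_eq, Set.mem_empty_iff_false, iff_false, not_lt]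
      have := h n
      rw [← h0, mul_zero] at this
      linarith
    simp [this]
  · refine (measure_mono fun n hn => ?_).trans
      ((weight_tail_le (div_pos ht h0)).trans (ENNReal.ofReal_le_ofReal (le_of_eq ?_)))
    · exact (div_lt_iff₀ h0).2 (lt_of_lt_of_le hn (h n))
    · rw [← hF]
      field_simp

/-- Plancherel, because `(n+1)^(-4) (n+1)^5 = n+1`. -/
lemma lintegral_scaledNorm_sq {f : SU2 → ℂ} (hf : MemLp f 2 haarSU2) :
    ∫⁻ n, ENNReal.ofReal (scaledNorm f n ^ 2) ∂weight =
      ∫⁻ u, ENNReal.ofReal (‖f u‖ ^ 2) ∂haarSU2 := by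
  have h := plancherel hf
  have e : ∀ n : ℕ, ENNReal.ofReal ((((n : ℝ) + 1) ^ 4)⁻¹) * ENNReal.ofReal (scaledNorm f n ^ 2) =
      ENNReal.ofReal (((n : ℝ) + 1) * hsNorm (fourierCoeff f n) ^ 2) := by
    intro n
    have hn : (0 : ℝ) < n + 1 := by positivity
    have e : (((n : ℝ) + 1) ^ (5 / 2 : ℝ)) ^ 2 = ((n : ℝ) + 1) ^ 5 := by
      rw [← Real.rpow_natCast, ← Real.rpow_mul hn.le, ← Real.rpow_natCast]
      norm_num
    rw [← ENNReal.ofReal_mul (by positivity), scaledNorm, mul_pow, e]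
    congr 1
    field_simp
  rw [lintegral_weight, tsum_congr e, ← ENNReal.ofReal_tsum_of_nonneg
    (fun n => by positivity) h.summable, h.tsum_eq, ENNReal.ofReal_pow ENNReal.toReal_nonneg,
    ENNReal.ofReal_toReal hf.2.ne, ← ENNReal.rpow_natCast,
    eLpNorm_eq_lintegral_rpow_enorm_toReal two_ne_zero ENNReal.ofNat_ne_top, ← ENNReal.rpow_mul]
  simp only [ENNReal.toReal_ofNat, Nat.cast_ofNat, one_div, inv_mul_cancel₀ (two_ne_zero' ℝ),
    ENNReal.rpow_one]
  refine lintegral_congr fun u => ?_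
  rw [ENNReal.ofReal_pow (norm_nonneg _), ofReal_norm, ← ENNReal.rpow_natCast]
  simp

lemma weight_scaledNorm_le_of_memLp {f : SU2 → ℂ} (hf : MemLp f 2 haarSU2) {t : ℝ} (ht : 0 < t) :
    weight {n | t < scaledNorm f n} ≤
      ENNReal.ofReal (1 / t ^ 2) * ∫⁻ u, ENNReal.ofReal (‖f u‖ ^ 2) ∂haarSU2 := by
  rw [← lintegral_scaledNorm_sq hf]
  have h := mul_meas_ge_le_lintegral (μ := weight) (f := fun n => ENNReal.ofReal (scaledNorm f n ^ 2))
    (Measurable.of_discrete) (ENNReal.ofReal (t ^ 2))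
  have hsub : weight {n | t < scaledNorm f n} ≤
      weight {n | ENNReal.ofReal (t ^ 2) ≤ ENNReal.ofReal (scaledNorm f n ^ 2)} := by
    refine measure_mono fun n hn => ENNReal.ofReal_le_ofReal ?_
    exact pow_le_pow_left₀ ht.le (le_of_lt hn) 2
  calc weight {n | t < scaledNorm f n}
      = ENNReal.ofReal (1 / t ^ 2) * (ENNReal.ofReal (t ^ 2) * weight {n | t < scaledNorm f n}) := by
        rw [← mul_assoc, ← ENNReal.ofReal_mul (by positivity), one_div_mul_cancel (by positivity),
          ENNReal.ofReal_one, one_mul]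
    _ ≤ _ := mul_le_mul_right ((mul_le_mul_right hsub _).trans h) _

/-- Split `f` at height `t`: the large part is integrable, the small part bounded. One of the two
must exceed `t/2`, whence `6/t = 3/(t/2)` and `4/t² = 1/(t/2)²`. -/
lemma weight_scaledNorm_le {f : SU2 → ℂ} (hf : Integrable f haarSU2) (hfm : Measurable f) {t : ℝ}
    (ht : 0 < t) : weight {n | t < scaledNorm f n} ≤
      ENNReal.ofReal (6 / t) * ∫⁻ u in {u | t < ‖f u‖}, ENNReal.ofReal ‖f u‖ ∂haarSU2 +
      ENNReal.ofReal (4 / t ^ 2) *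
        ∫⁻ u in {u | t < ‖f u‖}ᶜ, ENNReal.ofReal (‖f u‖ ^ 2) ∂haarSU2 := by
  set s : Set SU2 := {u | t < ‖f u‖} with hs
  have hsm : MeasurableSet s := measurableSet_lt measurable_const hfm.norm
  have h1 : Integrable (s.indicator f) haarSU2 := hf.indicator hsm
  have h2 : MemLp (sᶜ.indicator f) 2 haarSU2 := by
    refine MemLp.of_bound (hfm.indicator hsm.compl).aestronglyMeasurable t ?_
    filter_upwards with u
    by_cases hu : u ∈ s
    · simp [hu, ht.le]
    · simpa [hu] using not_lt.1 hu
  have hadd : ∀ n, scaledNorm f n ≤ scaledNorm (s.indicator f) n + scaledNorm (sᶜ.indicator f) n := by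
    intro n
    rw [scaledNorm, scaledNorm, scaledNorm, ← mul_add]
    refine mul_le_mul_of_nonneg_left ?_ (by positivity)
    conv_lhs => rw [← Set.indicator_self_add_compl s f]
    rw [fourierCoeff_add h1 (hf.indicator hsm.compl)]
    exact hsNorm_add_le _ _
  have hsub : {n | t < scaledNorm f n} ⊆ {n | t / 2 < scaledNorm (s.indicator f) n} ∪
      {n | t / 2 < scaledNorm (sᶜ.indicator f) n} := by
    intro n hn
    by_contra h
    simp only [Set.mem_union, Set.mem_ofPred_eq, not_or, not_lt] at h hn
    linarith [hadd n]
  refine ((measure_mono hsub).trans (measure_union_le _ _)).trans (add_le_add ?_ ?_)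
  · refine (weight_scaledNorm_le_of_integrable h1 (half_pos ht)).trans (le_of_eq ?_)
    congr 1
    · congr 1; field_simp; norm_num
    · rw [← lintegral_indicator hsm]
      refine lintegral_congr fun u => ?_
      by_cases hu : u ∈ s <;> simp [hu]
  · refine (weight_scaledNorm_le_of_memLp h2 (half_pos ht)).trans (le_of_eq ?_)
    congr 1
    · congr 1; field_simp; norm_num
    · rw [← lintegral_indicator hsm.compl]
      refine lintegral_congr fun u => ?_
      by_cases hu : u ∈ s <;> simp [hu]

lemma ofReal_toReal_eLpNorm_rpow {f : SU2 → ℂ} {p : ℝ} (hp : 0 < p)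
    (hf : MemLp f (ENNReal.ofReal p) haarSU2) :
    ENNReal.ofReal ((eLpNorm f (ENNReal.ofReal p) haarSU2).toReal ^ p) =
      ∫⁻ u, ENNReal.ofReal (‖f u‖ ^ p) ∂haarSU2 := by
  rw [← ENNReal.ofReal_rpow_of_nonneg ENNReal.toReal_nonneg hp.le, ENNReal.ofReal_toReal hf.2.ne,
    eLpNorm_eq_lintegral_rpow_enorm_toReal (ENNReal.ofReal_pos.2 hp).ne' ENNReal.ofReal_ne_top,
    ← ENNReal.rpow_mul, ENNReal.toReal_ofReal hp.le, one_div_mul_cancel hp.ne', ENNReal.rpow_one]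
  refine lintegral_congr fun u => ?_
  rw [← ENNReal.ofReal_rpow_of_nonneg (norm_nonneg _) hp.le, ofReal_norm]

lemma tsum_ofReal_le {p : ℝ} (hp1 : 1 < p) (hp2 : p < 2) {f : SU2 → ℂ}
    (hf : MemLp f (ENNReal.ofReal p) haarSU2) :
    ∑' n : ℕ, ENNReal.ofReal
        (((n : ℝ) + 1) ^ (5 * p / 2 - 4) * hsNorm (fourierCoeff f n) ^ p) ≤
      ENNReal.ofReal (p * (6 / (p - 1) + 4 / (2 - p)) *
        (eLpNorm f (ENNReal.ofReal p) haarSU2).toReal ^ p) := by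
  -- Both sides depend only on the almost-everywhere class of `f`.
  wlog hfm : Measurable f generalizing f
  · have h := this (hf.ae_eq hf.1.ae_eq_mk) hf.1.stronglyMeasurable_mk.measurable
    rw [← eLpNorm_congr_ae hf.1.ae_eq_mk] at h
    simpa only [← fourierCoeff_congr hf.1.ae_eq_mk] using h
  have hp0 : 0 < p := by linarith
  have hi : Integrable f haarSU2 := hf.integrable (by simpa using hp1.le)
  have h := lintegral_rpow_le_of_weak_type (ν := weight) (μ := haarSU2) (a := scaledNorm f)
    Measurable.of_discrete (scaledNorm_nonneg f) hfm.norm (fun u => norm_nonneg _) hp1 hp2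
    (C := 6) (D := 4) (by norm_num) (by norm_num)
    fun t ht => weight_scaledNorm_le hi hfm ht
  have hK : 0 ≤ p * (6 / (p - 1) + 4 / (2 - p)) := by
    have : 0 < p - 1 := by linarith
    have : 0 < 2 - p := by linarith
    positivity
  rw [← ofReal_toReal_eLpNorm_rpow hp0 hf, ← ENNReal.ofReal_mul hK, lintegral_weight] at h
  refine (le_of_eq (tsum_congr fun n => ?_)).trans h
  have hn : (0 : ℝ) < n + 1 := by positivity
  rw [← ENNReal.ofReal_mul (by positivity), scaledNorm,
    Real.mul_rpow (by positivity) (hsNorm_nonneg _), ← mul_assoc, ← Real.rpow_mul hn.le,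
    Real.rpow_sub hn]
  congr 2
  rw [show (4 : ℝ) = (4 : ℕ) by norm_num, Real.rpow_natCast, div_eq_inv_mul]
  congr 2
  ring

end SUTwo

theorem theorem2p2 :
    (∀ p : ℝ, 1 < p → p ≤ 2 → ∃ c : ℝ, 0 < c ∧
      ∀ f : SUTwo.SU2 → ℂ, MemLp f (ENNReal.ofReal p) SUTwo.haarSU2 →
        Summable (fun n : ℕ =>
          ((n : ℝ) + 1) ^ (5 * p / 2 - 4) * SUTwo.hsNorm (SUTwo.fourierCoeff f n) ^ p) ∧
        ∑' n : ℕ, ((n : ℝ) + 1) ^ (5 * p / 2 - 4) * SUTwo.hsNorm (SUTwo.fourierCoeff f n) ^ p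
          ≤ c * (eLpNorm f (ENNReal.ofReal p) SUTwo.haarSU2).toReal ^ p) ∧
    (∀ f : SUTwo.SU2 → ℂ, MemLp f 2 SUTwo.haarSU2 →
      HasSum (fun n : ℕ => ((n : ℝ) + 1) * SUTwo.hsNorm (SUTwo.fourierCoeff f n) ^ 2)
        ((eLpNorm f 2 SUTwo.haarSU2).toReal ^ 2)) := by
  refine ⟨fun p hp1 hp2 => ?_, fun f hf => SUTwo.plancherel hf⟩
  -- The interpolation constant blows up as `p → 2`; the endpoint is Plancherel with constant `1`.
  rcases hp2.lt_or_eq with hp2 | rfl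
  · have h1 : 0 < p - 1 := by linarith
    have h2 : 0 < 2 - p := by linarith
    have hK : 0 < p * (6 / (p - 1) + 4 / (2 - p)) := by positivity
    refine ⟨_, hK, fun f hf => ?_⟩
    have h := SUTwo.tsum_ofReal_le hp1 hp2 hf
    have h0 : ∀ n : ℕ, 0 ≤ ((n : ℝ) + 1) ^ (5 * p / 2 - 4) *
        SUTwo.hsNorm (SUTwo.fourierCoeff f n) ^ p := fun n =>
      mul_nonneg (by positivity) (Real.rpow_nonneg (SUTwo.hsNorm_nonneg _) _)
    have hs : Summable fun n : ℕ => ((n : ℝ) + 1) ^ (5 * p / 2 - 4) *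
        SUTwo.hsNorm (SUTwo.fourierCoeff f n) ^ p := by
      have := ENNReal.summable_toReal (h.trans_lt ENNReal.ofReal_lt_top).ne
      simpa only [ENNReal.toReal_ofReal (h0 _)] using this
    refine ⟨hs, ?_⟩
    rw [← ENNReal.ofReal_tsum_of_nonneg h0 hs] at h
    exact (ENNReal.ofReal_le_ofReal_iff (by positivity)).1 h
  · refine ⟨1, one_pos, fun f hf => ?_⟩
    rw [ENNReal.ofReal_ofNat] at hf ⊢
    have h := SUTwo.plancherel hf
    have e : (fun n : ℕ => ((n : ℝ) + 1) ^ (5 * (2 : ℝ) / 2 - 4) *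
        SUTwo.hsNorm (SUTwo.fourierCoeff f n) ^ (2 : ℝ)) =
        fun n : ℕ => ((n : ℝ) + 1) * SUTwo.hsNorm (SUTwo.fourierCoeff f n) ^ 2 := by
      funext n
      rw [show 5 * (2 : ℝ) / 2 - 4 = 1 by norm_num, Real.rpow_one, Real.rpow_two]
    rw [e, Real.rpow_two, one_mul]
    exact ⟨h.summable, h.tsum_eq.le⟩
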